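/- Let $k$ be a field and let $\mathscr C$ be a finite category (finitely many objects and morphisms) that is skeletal (isomorphic objects are equal) and locally trivial (every endomorphism is an identity). Let $k\mathscr C$ be its category algebra: the $k$-vector space with basis the set of morphisms of $\mathscr C$, with product $g\cdot f=g\circ f$ for morphisms if the composite is defined and $g\cdot f=0$ otherwise, extended bilinearly; its identity is $\sum_{c}1_c$. For a finite-dimensional $k$-algebra $A$ that splits over $k$ (that is, $A/\mathrm{rad}(A)$ is isomorphic to a finite product of matrix algebras over $k$), the quiver $Q(A)$ has as vertices the isomorphism classes of simple left $A$-modules, and the number of arrows from $S$ to $T$ is $\dim_k \mathrm{Ext}^1_A(S,T)$. A morphism $f$ of $\mathscr C$ is irreducible if it is neither a split monomorphism nor a split epimorphism and, whenever $f=gh$, either $h$ is a split monomorphism or $g$ is a split epimorphism; $\mathrm{Irr}_{\mathscr C}(c,d)$ denotes the set of irreducible morphisms from $c$ to $d$. The quiver $Q(\mathscr C)$ has as vertices the isomorphism classes of objects of $\mathscr C$, and as arrows the irreducible morphisms between fixed representatives of these classes. **Theorem.** The algebra $k\mathscr C$ splits over $k$, and $Q(k\mathscr C)\cong Q(\mathscr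 C)$ as quivers. Explicitly, $Q(k\mathscr C)$ is isomorphic to the quiver with vertex set the set of objects of $\mathscr C$ and arrow set $\mathrm{Irr}_{\mathscr C}(c,d)$ from $c$ to $d$. Here the vertex $c$ corresponds to the class of the simple module $S_c$ on which $1_c$ acts as the identity and every other morphism of $\mathscr C$ acts as zero; in particular $\dim_k \mathrm{Ext}^1_{k\mathscr C}(S_c,S_d)=|\mathrm{Irr}_{\mathscr C}(c,d)|$ for all objects $c,d$. -/

import Mathlib

open CategoryTheory

universe w v u v₁ u₁ v₂ u₂

noncomputable section

/-! ### Categories: local triviality, irreducible morphisms, the quiver of a category -/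

/-- A category is locally trivial if every endomorphism monoid is trivial. -/
def LocallyTrivial (C : Type u) [Category.{v} C] : Prop :=
  ∀ (c : C) (f : c ⟶ c), f = 𝟙 c

/-- A morphism `f` is irreducible if it is neither a split monomorphism nor a split epimorphism,
and whenever `f = g ∘ h` (that is, `f = h ≫ g`), either `h` is a split monomorphism or `g` is a
split epimorphism. -/
structure IsIrreducibleMorphism {C : Type u} [Category.{v} C] {c d : C} (f : c ⟶ d) : Prop where
  not_splitMono : ¬ IsSplitMono f
  not_splitEpi : ¬ IsSplitEpi f
  splitMono_or_splitEpi : ∀ (x : C) (h : c ⟶ x) (g : x ⟶ d), f = h ≫ g →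
    IsSplitMono h ∨ IsSplitEpi g

/-- `Irr c d` is the set of irreducible morphisms from `c` to `d`. -/
def Irr {C : Type u} [Category.{v} C] (c d : C) : Type v :=
  {f : c ⟶ d // IsIrreducibleMorphism f}

/-- The vertices of the quiver `Q(C)` of a category: isomorphism classes of objects. -/
def CategoryQuiver (C : Type u) [Category.{v} C] : Type u :=
  Quotient (isIsomorphicSetoid C)

/-- The quiver `Q(C)`: its arrows are the irreducible morphisms between fixed representatives of
the isomorphism classes. -/
instance CategoryQuiver.instQuiver (C : Type u) [Category.{v} C] : Quiver.{v} (CategoryQuiver C) where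
  Hom x y := Irr (Quotient.out x) (Quotient.out y)

/-- The vertex set of the quiver of irreducible morphisms: the objects of `C` themselves. -/
def IrrQuiver (C : Type u) : Type u := C

/-- The quiver whose vertices are the objects of `C` and whose arrows from `c` to `d` are the
irreducible morphisms from `c` to `d`. -/
instance IrrQuiver.instQuiver (C : Type u) [Category.{v} C] : Quiver.{v} (IrrQuiver C) where
  Hom c d := Irr (C := C) c d

/-- An isomorphism of quivers: a bijection between the vertices, together with bijections between
the corresponding sets of arrows. -/
structure QuiverIso (V : Type u₁) (W : Type u₂) [Quiver.{v₁} V] [Quiver.{v₂} W] where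
  vertices : V ≃ W
  arrows : ∀ x y : V, (x ⟶ y) ≃ (vertices x ⟶ vertices y)

/-! ### The category algebra -/

/-- The set of all morphisms of `C`, each with its source and its target. -/
structure Arr (C : Type u) [Category.{v} C] where
  src : C
  tgt : C
  hom : src ⟶ tgt

/-- The set of all morphisms as a sigma type. -/
def Arr.equivSigma (C : Type u) [Category.{v} C] : Arr C ≃ (Σ c d : C, (c ⟶ d)) where
  toFun f := ⟨f.src, f.tgt, f.hom⟩
  invFun f := ⟨f.1, f.2.1, f.2.2⟩
  left_inv _ := rfl
  right_inv _ := rfl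

instance Arr.instFinite (C : Type u) [Category.{v} C] [Finite C] [∀ c d : C, Finite (c ⟶ d)] :
    Finite (Arr C) :=
  Finite.of_equiv _ (Arr.equivSigma C).symm

/-- The category algebra `kC`: the `k`-vector space with basis the set of morphisms of `C`. -/
def CategoryAlgebra (k : Type w) [Field k] (C : Type u) [Category.{v} C] : Type (max w u v) :=
  Arr C →₀ k

namespace CategoryAlgebra

variable (k : Type w) [Field k] (C : Type u) [Category.{v} C]

instance instAddCommGroup : AddCommGroup (CategoryAlgebra k C) :=
  inferInstanceAs (AddCommGroup (Arr C →₀ k))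

instance instModule : Module k (CategoryAlgebra k C) :=
  inferInstanceAs (Module k (Arr C →₀ k))

instance instFiniteDimensional [Finite C] [∀ c d : C, Finite (c ⟶ d)] :
    FiniteDimensional k (CategoryAlgebra k C) :=
  inferInstanceAs (FiniteDimensional k (Arr C →₀ k))

/-- The basis of `kC` formed by the morphisms of `C`. -/
def basis : Module.Basis (Arr C) k (CategoryAlgebra k C) :=
  Module.Basis.ofRepr (LinearEquiv.refl k (Arr C →₀ k))

variable {C}

/-- The basis element of `kC` given by a morphism `f : c ⟶ d`. -/
def of {c d : C} (f : c ⟶ d) : CategoryAlgebra k C := basis k C ⟨c, d, f⟩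

open scoped Classical in
/-- The product `g f` of two basis elements: it is the composite `g ∘ f` if the target of `f` is
the source of `g`, and `0` otherwise. -/
def mulArr (g f : Arr C) : CategoryAlgebra k C :=
  if h : f.tgt = g.src then of k (f.hom ≫ eqToHom h ≫ g.hom) else 0

variable (C)

/-- The multiplication of `kC`: the bilinear extension of the product of morphisms. -/
def mulLinear : CategoryAlgebra k C →ₗ[k] CategoryAlgebra k C →ₗ[k] CategoryAlgebra k C :=
  (basis k C).constr k fun g => (basis k C).constr k fun f => mulArr k g f

instance instMul : Mul (CategoryAlgebra k C) where
  mul a b := mulLinear k C a b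

/-- The identity of `kC` is the sum of the identity morphisms (when `C` has finitely many
objects). -/
instance instOne : One (CategoryAlgebra k C) where
  one := ∑ᶠ c : C, of k (𝟙 c)

theorem mul_def (a b : CategoryAlgebra k C) : a * b = mulLinear k C a b := rfl

theorem one_def : (1 : CategoryAlgebra k C) = ∑ᶠ c : C, of k (𝟙 c) := rfl

variable {C}

theorem basis_mul_basis (g f : Arr C) : basis k C g * basis k C f = mulArr k g f := by
  simp [mul_def, mulLinear]

theorem of_mul_of {c d e : C} (g : d ⟶ e) (f : c ⟶ d) : of k g * of k f = of k (f ≫ g) := by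
  simp [of, basis_mul_basis, mulArr]

theorem of_mul_of_of_ne {c d d' e : C} (g : d' ⟶ e) (f : c ⟶ d) (h : d ≠ d') :
    of k g * of k f = 0 := by
  simp [of, basis_mul_basis, mulArr, h]

variable (C)

theorem induction_on {p : CategoryAlgebra k C → Prop} (a : CategoryAlgebra k C)
    (zero : p 0) (add : ∀ x y, p x → p y → p (x + y))
    (smul : ∀ (r : k) (c d : C) (f : c ⟶ d), p (r • of k f)) : p a := by
  have ha : a ∈ Submodule.span k (Set.range (basis k C)) := by
    rw [(basis k C).span_eq]; trivial
  obtain ⟨l, rfl⟩ := (Finsupp.mem_span_range_iff_exists_finsupp).1 ha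
  refine Finset.sum_induction _ p add zero fun f _ => ?_
  exact smul _ f.src f.tgt f.hom

theorem smul_mul' (r : k) (a b : CategoryAlgebra k C) : (r • a) * b = r • (a * b) := by
  simp [mul_def]

theorem mul_smul' (r : k) (a b : CategoryAlgebra k C) : a * (r • b) = r • (a * b) := by
  simp [mul_def]

theorem add_mul' (a b c : CategoryAlgebra k C) : (a + b) * c = a * c + b * c := by
  simp [mul_def]

theorem mul_add' (a b c : CategoryAlgebra k C) : a * (b + c) = a * b + a * c := by
  simp [mul_def]

theorem zero_mul' (a : CategoryAlgebra k C) : 0 * a = 0 := by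
  simp [mul_def]

theorem mul_zero' (a : CategoryAlgebra k C) : a * 0 = 0 := by
  simp [mul_def]

theorem of_mul_assoc {a b c d e f : C} (x : e ⟶ f) (y : c ⟶ d) (z : a ⟶ b) :
    of k x * of k y * of k z = of k x * (of k y * of k z) := by
  by_cases h : d = e
  · subst h
    by_cases h' : b = c
    · subst h'
      simp [of_mul_of]
    · rw [of_mul_of, of_mul_of_of_ne k _ _ h', of_mul_of_of_ne k _ _ h', mul_zero']
  · by_cases h' : b = c
    · subst h'
      rw [of_mul_of, of_mul_of_of_ne k _ _ h, of_mul_of_of_ne k _ _ h, zero_mul']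
    · rw [of_mul_of_of_ne k _ _ h', of_mul_of_of_ne k _ _ h, mul_zero', zero_mul']

theorem mul_assoc' (a b c : CategoryAlgebra k C) : a * b * c = a * (b * c) := by
  induction a using induction_on with
  | zero => simp only [zero_mul']
  | add x y hx hy => simp only [add_mul', hx, hy]
  | smul r _ _ f =>
    induction b using induction_on with
    | zero => simp only [zero_mul', mul_zero']
    | add x y hx hy => simp only [add_mul', mul_add', hx, hy]
    | smul s _ _ g =>
      induction c using induction_on with
      | zero => simp only [mul_zero']
      | add x y hx hy => simp only [mul_add', hx, hy]
      | smul t _ _ h => simp only [smul_mul', mul_smul', of_mul_assoc]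

theorem one_eq_sum [Fintype C] : (1 : CategoryAlgebra k C) = ∑ c : C, of k (𝟙 c) := by
  rw [one_def, finsum_eq_sum_of_fintype]

theorem one_mul' [Finite C] (a : CategoryAlgebra k C) : 1 * a = a := by
  classical
  let := Fintype.ofFinite C
  induction a using induction_on with
  | zero => exact mul_zero' k C 1
  | add x y hx hy => rw [mul_add', hx, hy]
  | smul r c d f =>
    have : (1 : CategoryAlgebra k C) * of k f = of k f := by
      rw [one_eq_sum, mul_def, map_sum, LinearMap.sum_apply, Finset.sum_eq_single d]
      · rw [← mul_def, of_mul_of, Category.comp_id]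
      · intro e _ he
        rw [← mul_def, of_mul_of_of_ne k _ _ he.symm]
      · simp
    rw [mul_smul', this]

theorem mul_one' [Finite C] (a : CategoryAlgebra k C) : a * 1 = a := by
  classical
  let := Fintype.ofFinite C
  induction a using induction_on with
  | zero => exact zero_mul' k C 1
  | add x y hx hy => rw [add_mul', hx, hy]
  | smul r c d f =>
    have : of k f * (1 : CategoryAlgebra k C) = of k f := by
      rw [one_eq_sum, mul_def, map_sum, Finset.sum_eq_single c]
      · rw [← mul_def, of_mul_of, Category.id_comp]
      · intro e _ he
        rw [← mul_def, of_mul_of_of_ne k _ _ he]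
      · simp
    rw [smul_mul', this]

instance instRing [Finite C] : Ring (CategoryAlgebra k C) :=
  { instAddCommGroup k C, instMul k C, instOne k C with
    left_distrib := mul_add' k C
    right_distrib := add_mul' k C
    zero_mul := zero_mul' k C
    mul_zero := mul_zero' k C
    mul_assoc := mul_assoc' k C
    one_mul := one_mul' k C
    mul_one := mul_one' k C }

instance instAlgebra [Finite C] : Algebra k (CategoryAlgebra k C) :=
  Algebra.ofModule (smul_mul' k C) (mul_smul' k C)

end CategoryAlgebra

/-! ### The Gabriel quiver of a finite-dimensional algebra -/

/-- An algebra `A` splits over the field `k` if `A / rad A` is isomorphic to a finite product of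
full matrix algebras over `k`. -/
def SplitsOver (k : Type w) [Field k] (A : Type u) [Ring A] [Algebra k A] : Prop :=
  ∃ (n : ℕ) (m : Fin n → ℕ), (∀ i, 0 < m i) ∧
    Nonempty ((A ⧸ Ring.jacobson A) ≃ₐ[k] ∀ i, Matrix (Fin (m i)) (Fin (m i)) k)

/-- The simple left modules over a ring. -/
def SimpleMod (A : Type u) [Ring A] : Type (u + 1) :=
  {S : ModuleCat.{u} A // IsSimpleModule A S}

/-- The vertices of the Gabriel quiver `Q(A)` of a finite-dimensional algebra `A` that splits over
the field `k`: isomorphism classes of simple left `A`-modules. -/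
@[nolint unusedArguments]
def GabrielQuiver (k : Type w) [Field k] (A : Type u) [Ring A] [Algebra k A] : Type (u + 1) :=
  Quotient ((isIsomorphicSetoid (ModuleCat.{u} A)).comap (Subtype.val : SimpleMod A → _))

namespace GabrielQuiver

variable {k : Type w} [Field k] {A : Type u} [Ring A] [Algebra k A]

/-- The isomorphism class of a simple module. -/
def mk (S : SimpleMod A) : GabrielQuiver k A := Quotient.mk _ S

/-- A fixed representative of an isomorphism class of simple modules. -/
def rep (x : GabrielQuiver k A) : ModuleCat.{u} A := (Quotient.out x).1

/-- The Gabriel quiver `Q(A)`: the number of arrows from `S` to `T` is the dimension over `k` of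
`Ext¹_A(S, T)`. The arrows are the elements of (the index set of) a chosen `k`-basis of that
space. -/
instance instQuiver : Quiver.{u} (GabrielQuiver k A) where
  Hom x y := Module.Basis.ofVectorSpaceIndex k (Abelian.Ext.{u} (rep x) (rep y) 1)

end GabrielQuiver

end

noncomputable section

/-! ### Skeletal locally trivial categories -/

section LocallyTrivialCategory

variable {C : Type u} [Category.{v} C]

/-! Morphisms in both directions between two objects force the objects to be equal, so a composite
is an identity only if both factors are. Hence the coefficient of `𝟙 c` is a character of the
category algebra (`vertexCoeff_mul`). Every simple module is one-dimensional and given by one of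
these characters (`exists_isVertexModule`). The radical is therefore their common kernel, the
quotient is a product of copies of `k`, and objects biject with classes of simple modules.

For `Ext¹(S_c, S_d)`, map the projective `P_c = kC · 1_c` onto `S_c`. The kernel `R` is spanned over
`k` by the morphisms leaving `c` for another object. Every map `P_c → S_d` kills `R`, so the long
exact sequence gives `Ext¹(S_c, S_d) ≅ Hom(R, S_d)` (`homLinearEquivExtOne`). Such a homomorphism
vanishes on morphisms whose target is not `d`, and on those that factor through a third object. Its
values on the irreducible morphisms are arbitrary (`irrHom_injective`, `irrHom_surjective`), so
`Hom(R, S_d)` is the space of functions `Irr c d → k`. -/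

theorem LocallyTrivial.eq_of_hom_of_hom (hloc : LocallyTrivial C) (hskel : Skeletal C) {c d : C}
    (f : c ⟶ d) (g : d ⟶ c) : c = d :=
  hskel ⟨⟨f, g, hloc _ _, hloc _ _⟩⟩

/-- A one-sided inverse is a morphism backwards, so split monomorphisms and split epimorphisms are
exactly the identities. Irreducibility thus becomes a condition on endpoints alone. -/
theorem LocallyTrivial.isIrreducibleMorphism_iff (hloc : LocallyTrivial C) (hskel : Skeletal C)
    {c d : C} (f : c ⟶ d) : IsIrreducibleMorphism f ↔
      c ≠ d ∧ ∀ (x : C) (h : c ⟶ x) (g : x ⟶ d), f = h ≫ g → c = x ∨ x = d := by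
  have key {a b : C} (g : a ⟶ b) : a = b → IsSplitMono g ∧ IsSplitEpi g := by
    rintro rfl
    rw [hloc _ g]
    exact ⟨inferInstance, inferInstance⟩
  have keyMono {a b : C} (g : a ⟶ b) (_ : IsSplitMono g) : a = b :=
    hloc.eq_of_hom_of_hom hskel g (retraction g)
  have keyEpi {a b : C} (g : a ⟶ b) (_ : IsSplitEpi g) : a = b :=
    hloc.eq_of_hom_of_hom hskel g (section_ g)
  constructor
  · intro hf
    exact ⟨fun h => hf.not_splitMono (key f h).1, fun x h g e =>
      (hf.splitMono_or_splitEpi x h g e).imp (keyMono h) (keyEpi g)⟩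
  · rintro ⟨hne, hf⟩
    exact ⟨fun h => hne (keyMono f h), fun h => hne (keyEpi f h), fun x h g e =>
      (hf x h g e).imp (fun h' => (key h h').1) (fun h' => (key g h').2)⟩

theorem LocallyTrivial.arr_eq_id (hloc : LocallyTrivial C) {c d : C} (f : c ⟶ d) (h : c = d) :
    (⟨c, d, f⟩ : Arr C) = ⟨c, c, 𝟙 c⟩ := by
  subst h
  rw [hloc _ f]

theorem Arr.eq_id_iff {c a b : C} (f : a ⟶ b) (hloc : LocallyTrivial C) :
    (⟨a, b, f⟩ : Arr C) = ⟨c, c, 𝟙 c⟩ ↔ a = c ∧ b = c := by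
  constructor
  · intro h
    exact ⟨congrArg Arr.src h, congrArg Arr.tgt h⟩
  · rintro ⟨rfl, rfl⟩
    exact hloc.arr_eq_id f rfl

end LocallyTrivialCategory

namespace CategoryAlgebra

variable {k : Type w} [Field k] {C : Type u} [Category.{v} C]

/-! ### The characters of the category algebra -/

variable (k) in
/-- The coefficient of the identity of `c` in an element of the category algebra. -/
def vertexCoeff (c : C) : CategoryAlgebra k C →ₗ[k] k := (basis k C).coord ⟨c, c, 𝟙 c⟩

open scoped Classical in
theorem vertexCoeff_of (hloc : LocallyTrivial C) (c : C) {a b : C} (f : a ⟶ b) :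
    vertexCoeff k c (of k f) = if a = c ∧ b = c then 1 else 0 := by
  rw [vertexCoeff, of, Module.Basis.coord_apply, Module.Basis.repr_self, Finsupp.single_apply]
  exact if_congr (Arr.eq_id_iff f hloc) rfl rfl

theorem vertexCoeff_of_id (c : C) : vertexCoeff k c (of k (𝟙 c)) = 1 := by
  rw [vertexCoeff, of, Module.Basis.coord_apply, Module.Basis.repr_self, Finsupp.single_eq_same]

/-- If the composite is a loop at `c`, its factors run in opposite directions, so all objects
involved equal `c`. -/
theorem vertexCoeff_of_mul_of (hloc : LocallyTrivial C) (hskel : Skeletal C) (c : C)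
    {a b a' b' : C} (g : a' ⟶ b') (f : a ⟶ b) :
    vertexCoeff k c (of k g * of k f) = vertexCoeff k c (of k g) * vertexCoeff k c (of k f) := by
  classical
  by_cases h : b = a'
  · subst h
    rw [of_mul_of]
    simp only [vertexCoeff_of hloc]
    by_cases hb : a = c ∧ b' = c
    · obtain ⟨rfl, rfl⟩ := hb
      have := hloc.eq_of_hom_of_hom hskel f g
      simp [this]
    · rw [if_neg hb]
      split_ifs <;> simp_all
  · rw [of_mul_of_of_ne k _ _ h, map_zero]
    simp only [vertexCoeff_of hloc]
    split_ifs <;> simp_all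

variable [Finite C]

theorem vertexCoeff_mul (hloc : LocallyTrivial C) (hskel : Skeletal C) (c : C)
    (x y : CategoryAlgebra k C) :
    vertexCoeff k c (x * y) = vertexCoeff k c x * vertexCoeff k c y := by
  induction x using induction_on with
  | zero => simp
  | add x₁ x₂ h₁ h₂ => rw [add_mul, map_add, h₁, h₂, map_add, add_mul]
  | smul r _ _ g =>
    induction y using induction_on with
    | zero => simp
    | add y₁ y₂ h₁ h₂ => rw [mul_add, map_add, h₁, h₂, map_add, mul_add]
    | smul s _ _ f =>
      rw [smul_mul_smul_comm, map_smul, map_smul, map_smul, vertexCoeff_of_mul_of hloc hskel,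
        smul_mul_smul_comm]

theorem vertexCoeff_one (hloc : LocallyTrivial C) (c : C) :
    vertexCoeff k c (1 : CategoryAlgebra k C) = 1 := by
  classical
  let := Fintype.ofFinite C
  rw [one_eq_sum, map_sum, Finset.sum_eq_single c]
  · exact vertexCoeff_of_id c
  · intro b _ hb
    rw [vertexCoeff_of hloc, if_neg (fun h => hb h.1)]
  · simp

variable (k) in
/-- The character of the category algebra of a skeletal locally trivial category which is
supported at the object `c`. -/
def character (hloc : LocallyTrivial C) (hskel : Skeletal C) (c : C) :
    CategoryAlgebra k C →ₐ[k] k :=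
  AlgHom.ofLinearMap (vertexCoeff k c) (vertexCoeff_one hloc c) (vertexCoeff_mul hloc hskel c)

@[simp]
theorem character_apply (hloc : LocallyTrivial C) (hskel : Skeletal C) (c : C)
    (x : CategoryAlgebra k C) : character k hloc hskel c x = vertexCoeff k c x := rfl

theorem character_surjective (hloc : LocallyTrivial C) (hskel : Skeletal C) (c : C) :
    Function.Surjective (character k hloc hskel c) := fun r =>
  ⟨r • of k (𝟙 c), by rw [map_smul, character_apply, vertexCoeff_of_id, smul_eq_mul, mul_one]⟩

/-! ### Modules supported at a vertex -/

variable (k) in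
/-- A module over the category algebra is supported at the object `c` if the identity of `c` acts
as the identity and every other morphism acts as zero. -/
structure IsVertexModule (c : C) (S : Type*) [AddCommGroup S] [Module (CategoryAlgebra k C) S] :
    Prop where
  id_smul : ∀ s : S, of k (𝟙 c) • s = s
  of_smul : ∀ (a b : C) (f : a ⟶ b), (⟨a, b, f⟩ : Arr C) ≠ ⟨c, c, 𝟙 c⟩ → ∀ s : S, of k f • s = 0

section

variable {c : C} {S : Type*} [AddCommGroup S] [Module (CategoryAlgebra k C) S]

theorem IsVertexModule.smul_eq [Module k S] [IsScalarTower k (CategoryAlgebra k C) S]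
    (hS : IsVertexModule k c S) (x : CategoryAlgebra k C) (s : S) :
    x • s = vertexCoeff k c x • s := by
  classical
  induction x using induction_on with
  | zero => simp
  | add x₁ x₂ h₁ h₂ => rw [add_smul, h₁, h₂, map_add, add_smul]
  | smul r a b f =>
    rw [smul_assoc, map_smul, smul_assoc]
    congr 1
    by_cases h : (⟨a, b, f⟩ : Arr C) = ⟨c, c, 𝟙 c⟩
    · obtain rfl : a = c := congrArg Arr.src h
      obtain rfl : b = a := congrArg Arr.tgt h
      obtain rfl : f = 𝟙 b := by simpa using h
      rw [hS.id_smul, vertexCoeff_of_id, one_smul]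
    · rw [hS.of_smul a b f h, vertexCoeff, of, Module.Basis.coord_apply, Module.Basis.repr_self,
        Finsupp.single_eq_of_ne (Ne.symm h), zero_smul]

theorem isVertexModule_of_smul_eq (hloc : LocallyTrivial C) [Module k S]
    (h : ∀ (x : CategoryAlgebra k C) (s : S), x • s = vertexCoeff k c x • s) :
    IsVertexModule k c S := by
  classical
  refine ⟨fun s => ?_, fun a b f hf s => ?_⟩
  · rw [h, vertexCoeff_of_id, one_smul]
  · rw [h, vertexCoeff_of hloc, if_neg (fun h' => hf ((Arr.eq_id_iff f hloc).2 h')), zero_smul]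

theorem IsVertexModule.of_linearEquiv (hS : IsVertexModule k c S) {T : Type*} [AddCommGroup T]
    [Module (CategoryAlgebra k C) T] (e : S ≃ₗ[CategoryAlgebra k C] T) : IsVertexModule k c T := by
  refine ⟨fun t => e.symm.injective ?_, fun a b f hf t => e.symm.injective ?_⟩
  · rw [map_smul, hS.id_smul]
  · rw [map_smul, hS.of_smul a b f hf, map_zero]

theorem IsVertexModule.eq [Nontrivial S] (hS : IsVertexModule k c S) {d : C}
    (hS' : IsVertexModule k d S) : c = d := by
  by_contra hcd
  obtain ⟨s, hs⟩ := exists_ne (0 : S)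
  exact hs ((hS.id_smul s).symm.trans
    (hS'.of_smul c c (𝟙 c) (fun h => hcd (congrArg Arr.src h)) s))

end

/-- Every simple module over the category algebra of a finite skeletal locally trivial category is
supported at a vertex. -/
theorem exists_isVertexModule (hloc : LocallyTrivial C) (hskel : Skeletal C) (S : Type*)
    [AddCommGroup S] [Module (CategoryAlgebra k C) S] [IsSimpleModule (CategoryAlgebra k C) S] :
    ∃ c : C, IsVertexModule k c S := by
  classical
  let := Fintype.ofFinite C
  have := IsSimpleModule.nontrivial (CategoryAlgebra k C) S
  let : Module k S := Module.compHom S (algebraMap k (CategoryAlgebra k C))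
  have : IsScalarTower k (CategoryAlgebra k C) S := ⟨fun r x s => by
    rw [Algebra.smul_def, mul_smul]; rfl⟩
  have : SMulCommClass k (CategoryAlgebra k C) S := IsScalarTower.to_smulCommClass
  -- Targets lie below sources: a minimal object of the support of `S` has no morphism to another
  -- object of the support.
  let r : C → C → Prop := fun d c => c ≠ d ∧ Nonempty (c ⟶ d)
  have : IsTrans C r := ⟨fun a b c ⟨h₁, ⟨f⟩⟩ ⟨h₂, ⟨g⟩⟩ => ⟨by
    rintro rfl
    exact h₁ (hloc.eq_of_hom_of_hom hskel f g), ⟨g ≫ f⟩⟩⟩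
  have : Std.Irrefl r := ⟨fun a h => h.1 rfl⟩
  have wf := Finite.wellFounded_of_trans_of_irrefl r
  have hne : {c : C | ∃ s : S, of k (𝟙 c) • s ≠ 0}.Nonempty := by
    by_contra hemp
    obtain ⟨s, hs⟩ := exists_ne (0 : S)
    apply hs
    rw [← one_smul (CategoryAlgebra k C) s, one_eq_sum, Finset.sum_smul]
    refine Finset.sum_eq_zero fun c _ => ?_
    by_contra h
    exact hemp ⟨c, s, h⟩
  obtain ⟨c, ⟨s, hs⟩, hmin⟩ := wf.has_min _ hne
  -- The vector `1_c s` is a common eigenvector, so the submodule it generates is a line, which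
  -- simplicity makes all of `S`.
  have key (x : CategoryAlgebra k C) :
      x • of k (𝟙 c) • s = vertexCoeff k c x • of k (𝟙 c) • s := by
    induction x using induction_on with
    | zero => simp
    | add x₁ x₂ h₁ h₂ => rw [add_smul, h₁, h₂, map_add, add_smul]
    | smul t a b f =>
      rw [smul_assoc, map_smul, smul_assoc]
      congr 1
      rw [vertexCoeff_of hloc]
      by_cases ha : c = a
      · subst ha
        by_cases hb : c = b
        · subst hb
          rw [hloc _ f, if_pos ⟨rfl, rfl⟩, ← mul_smul, of_mul_of, Category.comp_id, one_smul]
        · rw [if_neg (fun h => hb h.2.symm), zero_smul, ← Category.comp_id f, ← of_mul_of,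
            mul_smul]
          -- A nonzero image under `f` would be fixed by `1_b`, putting `b` in the support below
          -- `c`.
          by_contra h
          exact hmin b ⟨_, h⟩ ⟨hb, ⟨f⟩⟩
      · rw [if_neg (fun h => ha h.1.symm), zero_smul, ← mul_smul, of_mul_of_of_ne k _ _ ha,
          zero_smul]
  refine ⟨c, isVertexModule_of_smul_eq hloc fun x t => ?_⟩
  obtain ⟨y, rfl⟩ := IsSimpleModule.toSpanSingleton_surjective (CategoryAlgebra k C) hs t
  rw [LinearMap.toSpanSingleton_apply, key y, smul_comm, key x, smul_comm]

/-! ### The simple module at a vertex -/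

variable (k) in
/-- The simple module supported at the object `c`, as the quotient of the category algebra by the
kernel of the character at `c`. -/
abbrev VertexSimple (hloc : LocallyTrivial C) (hskel : Skeletal C) (c : C) : Type (max w u v) :=
  CategoryAlgebra k C ⧸ RingHom.ker (character k hloc hskel c)

instance isSimpleModule_vertexSimple (hloc : LocallyTrivial C) (hskel : Skeletal C) (c : C) :
    IsSimpleModule (CategoryAlgebra k C) (VertexSimple k hloc hskel c) :=
  isSimpleModule_iff_isCoatom.2 (Ideal.isMaximal_def.1
    (RingHom.ker_isMaximal_of_surjective _ (character_surjective hloc hskel c)))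

theorem isVertexModule_vertexSimple (hloc : LocallyTrivial C) (hskel : Skeletal C) (c : C) :
    IsVertexModule k c (VertexSimple k hloc hskel c) := by
  refine isVertexModule_of_smul_eq hloc fun x s => ?_
  obtain ⟨y, rfl⟩ := Submodule.Quotient.mk_surjective _ s
  rw [← Submodule.Quotient.mk_smul, ← Submodule.Quotient.mk_smul, Submodule.Quotient.eq,
    RingHom.mem_ker, map_sub, smul_eq_mul, map_mul, AlgHom.map_smul_of_tower, character_apply,
    character_apply, smul_eq_mul, sub_self]

/-- A nonzero vector is annihilated by the kernel of the character, and a nonzero map between simple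
modules is bijective. -/
theorem IsVertexModule.nonempty_linearEquiv (hloc : LocallyTrivial C) (hskel : Skeletal C) {c : C}
    {S : Type*} [AddCommGroup S] [Module (CategoryAlgebra k C) S]
    [IsSimpleModule (CategoryAlgebra k C) S] (hS : IsVertexModule k c S) :
    Nonempty (VertexSimple k hloc hskel c ≃ₗ[CategoryAlgebra k C] S) := by
  have := IsSimpleModule.nontrivial (CategoryAlgebra k C) S
  let : Module k S := Module.compHom S (algebraMap k (CategoryAlgebra k C))
  have : IsScalarTower k (CategoryAlgebra k C) S := ⟨fun r x s => by
    rw [Algebra.smul_def, mul_smul]; rfl⟩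
  obtain ⟨s, hs⟩ := exists_ne (0 : S)
  let f : VertexSimple k hloc hskel c →ₗ[CategoryAlgebra k C] S :=
    Submodule.liftQ _ (LinearMap.toSpanSingleton (CategoryAlgebra k C) S s) fun x hx => by
      rw [LinearMap.mem_ker, LinearMap.toSpanSingleton_apply, hS.smul_eq]
      rw [RingHom.mem_ker, character_apply] at hx
      rw [hx, zero_smul]
  have hf : f ≠ 0 := fun h => hs (by
    have h1 := LinearMap.congr_fun h (Submodule.Quotient.mk 1)
    rw [Submodule.liftQ_apply, LinearMap.toSpanSingleton_apply, one_smul] at h1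
    exact h1)
  exact ⟨LinearEquiv.ofBijective f (LinearMap.bijective_of_ne_zero hf)⟩

/-! ### The radical of the category algebra -/

theorem mem_jacobson_iff (hloc : LocallyTrivial C) (hskel : Skeletal C)
    (x : CategoryAlgebra k C) :
    x ∈ Ring.jacobson (CategoryAlgebra k C) ↔ ∀ c : C, vertexCoeff k c x = 0 := by
  constructor
  · intro hx c
    have := RingHom.ker_isMaximal_of_surjective _ (character_surjective (k := k) hloc hskel c)
    exact Ring.jacobson_le_of_isMaximal (RingHom.ker (character k hloc hskel c)) hx
  · intro hx
    rw [Ring.jacobson_eq_sInf_isMaximal, Submodule.mem_sInf]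
    intro I hI
    have : IsSimpleModule (CategoryAlgebra k C) (CategoryAlgebra k C ⧸ I) :=
      isSimpleModule_iff_isCoatom.2 (Ideal.isMaximal_def.1 hI)
    -- Here `x` acts on the simple quotient through a character that vanishes at `x`; applied to the
    -- class of `1` this says `x ∈ I`.
    obtain ⟨c, hc⟩ := exists_isVertexModule (k := k) hloc hskel (CategoryAlgebra k C ⧸ I)
    have h := hc.smul_eq x (Submodule.Quotient.mk 1)
    rw [hx c, zero_smul, ← Submodule.Quotient.mk_smul, smul_eq_mul, mul_one] at h
    exact (Submodule.Quotient.mk_eq_zero I).1 h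

theorem splitsOver (hloc : LocallyTrivial C) (hskel : Skeletal C) :
    SplitsOver k (CategoryAlgebra k C) := by
  classical
  let := Fintype.ofFinite C
  let φ : CategoryAlgebra k C →ₐ[k] (C → k) := AlgHom.pi (character k hloc hskel)
  have hφ : Function.Surjective φ := fun r => ⟨∑ c, r c • of k (𝟙 c), by
    ext d
    simp only [φ, AlgHom.pi_apply, character_apply, map_sum, map_smul, vertexCoeff_of hloc]
    rw [Finset.sum_eq_single d] <;> simp +contextual⟩
  have hker : Ring.jacobson (CategoryAlgebra k C) = RingHom.ker φ := by
    ext x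
    rw [mem_jacobson_iff hloc hskel, RingHom.mem_ker, funext_iff]
    rfl
  have hmat : Function.Bijective (Algebra.ofId k (Matrix (Fin 1) (Fin 1) k)) :=
    ⟨(Algebra.ofId k (Matrix (Fin 1) (Fin 1) k)).toRingHom.injective, fun M => ⟨M 0 0, by
      ext i j
      simp [Algebra.ofId_apply, Matrix.algebraMap_matrix_apply, Subsingleton.elim i 0,
        Subsingleton.elim j 0]⟩⟩
  refine ⟨Nat.card C, fun _ => 1, fun _ => one_pos, ⟨?_⟩⟩
  exact (Ideal.quotientEquivAlgOfEq k hker).trans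
    ((Ideal.quotientKerAlgEquivOfSurjective hφ).trans
      ((AlgEquiv.piCongrLeft' k (fun _ => k) (Finite.equivFin C)).trans
        (AlgEquiv.piCongrRight fun _ => AlgEquiv.ofBijective (Algebra.ofId k _) hmat)))

end CategoryAlgebra

/-! ### `Ext¹` from a projective cover -/

section ExtOne

open scoped ModuleCat

variable {k : Type w} [Field k] {A : Type u} [Ring A] [Algebra k A]

/-- If `0 → X₁ → X₂ → X₃ → 0` is exact, `X₂` is projective and every morphism `X₂ ⟶ Y` vanishes on
`X₁`, then `Ext¹(X₃, Y)` is the space of morphisms from `X₁` to `Y`. -/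
def CategoryTheory.ShortComplex.ShortExact.homLinearEquivExtOne {S : ShortComplex (ModuleCat.{u} A)}
    (hS : S.ShortExact) [Projective S.X₂] (Y : ModuleCat.{u} A)
    (hY : ∀ g : S.X₂ ⟶ Y, S.f ≫ g = 0) :
    (S.X₁ ⟶ Y) ≃ₗ[k] Abelian.Ext.{u} S.X₃ Y 1 :=
  (Abelian.Ext.linearEquiv₀ (R := k)).symm.trans <|
    LinearEquiv.ofBijective (Abelian.Ext.precompOfLinear hS.extClass k Y (add_zero 1)) <| by
      constructor
      -- The kernel of the connecting map consists of restrictions of maps `X₂ ⟶ Y`, all zero by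
      -- `hY`.
      · rw [injective_iff_map_eq_zero]
        intro x hx
        obtain ⟨y, rfl⟩ := Abelian.Ext.contravariant_sequence_exact₁ hS Y x (add_zero 1) hx
        obtain ⟨g, rfl⟩ := (Abelian.Ext.linearEquiv₀ (R := k)).symm.surjective y
        rw [Abelian.Ext.linearEquiv₀_symm_apply, Abelian.Ext.mk₀_comp_mk₀, hY,
          Abelian.Ext.mk₀_zero]
      -- The obstruction to surjectivity lies in `Ext¹(X₂, Y)`, which is zero by projectivity.
      · intro y
        obtain ⟨x, hx⟩ := Abelian.Ext.contravariant_sequence_exact₃ hS Y y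
          (Abelian.Ext.eq_zero_of_projective _) (add_zero 1)
        exact ⟨x, hx⟩

end ExtOne

namespace CategoryAlgebra

variable {k : Type w} [Field k] {C : Type u} [Category.{v} C] [Finite C]

/-! ### The projective module at a vertex -/

variable (k) in
/-- The left ideal of the category algebra generated by the identity of `c`. -/
def vertexProjective (c : C) : Submodule (CategoryAlgebra k C) (CategoryAlgebra k C) where
  carrier := {x | x * of k (𝟙 c) = x}
  add_mem' {x y} hx hy := by
    change (x + y) * _ = _
    rw [add_mul, hx, hy]
  zero_mem' := zero_mul _
  smul_mem' a x hx := by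
    change (a * x) * _ = _
    rw [mul_assoc, hx]
    rfl

theorem mem_vertexProjective {c : C} {x : CategoryAlgebra k C} :
    x ∈ vertexProjective k c ↔ x * of k (𝟙 c) = x := Iff.rfl

theorem of_mem_vertexProjective {c d : C} (f : c ⟶ d) : of k f ∈ vertexProjective k c := by
  rw [mem_vertexProjective, of_mul_of, Category.id_comp]

theorem mul_of_id_mem_vertexProjective (c : C) (x : CategoryAlgebra k C) :
    x * of k (𝟙 c) ∈ vertexProjective k c := by
  rw [mem_vertexProjective, mul_assoc, of_mul_of, Category.id_comp]

variable (k) in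
/-- The retraction of the category algebra onto the projective module at `c`. -/
def vertexRetraction (c : C) :
    CategoryAlgebra k C →ₗ[CategoryAlgebra k C] vertexProjective k c where
  toFun x := ⟨x * of k (𝟙 c), mul_of_id_mem_vertexProjective c x⟩
  map_add' x y := Subtype.ext (add_mul x y _)
  map_smul' a x := Subtype.ext (mul_assoc a x _)

theorem vertexRetraction_apply (c : C) (x : vertexProjective k c) :
    vertexRetraction k c x = x :=
  Subtype.ext (mem_vertexProjective.1 x.2)

instance projective_vertexProjective (c : C) :
    Module.Projective (CategoryAlgebra k C) (vertexProjective k c) := by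
  refine Module.Projective.of_split (vertexProjective k c).subtype (vertexRetraction k c) ?_
  refine LinearMap.ext fun x => ?_
  rw [LinearMap.comp_apply, LinearMap.id_apply, Submodule.subtype_apply, vertexRetraction_apply]

variable (k) in
/-- The span of the morphisms with source `c` and a different target. -/
def outSpan (c : C) : Submodule k (CategoryAlgebra k C) :=
  Submodule.span k {x | ∃ (d : C) (f : c ⟶ d), c ≠ d ∧ x = of k f}

/-- Right multiplication by `1_c` keeps the morphisms with source `c`, and among them only the
identity has target `c`. -/
theorem mul_of_id_sub_mem_outSpan (hloc : LocallyTrivial C) (c : C) (x : CategoryAlgebra k C) :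
    x * of k (𝟙 c) - vertexCoeff k c x • of k (𝟙 c) ∈ outSpan k c := by
  classical
  induction x using induction_on with
  | zero => simp
  | add x y hx hy =>
    convert! add_mem hx hy using 1
    rw [add_mul, map_add, add_smul]
    abel
  | smul r a b f =>
    rw [smul_mul_assoc, map_smul, smul_assoc, ← smul_sub]
    refine Submodule.smul_mem _ _ ?_
    rw [vertexCoeff_of hloc]
    by_cases ha : c = a
    · subst ha
      rw [of_mul_of, Category.id_comp]
      by_cases hb : c = b
      · subst hb
        rw [hloc _ f]
        simp
      · rw [if_neg (fun h => hb h.2.symm), zero_smul, sub_zero]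
        exact Submodule.subset_span ⟨b, f, hb, rfl⟩
    · rw [of_mul_of_of_ne k _ _ ha, if_neg (fun h => ha h.1.symm)]
      simp

/-! ### Linear maps prescribed on irreducible morphisms -/

section IrrMap

variable {c d : C} {T : Type*} [AddCommGroup T] [Module k T]

/-- The linear map which sends an irreducible morphism from `c` to `d` to a multiple of a given
vector, and all other morphisms to zero. -/
def irrMap (t : T) : (Irr c d → k) →ₗ[k] CategoryAlgebra k C →ₗ[k] T :=
  ((basis k C).constr k).toLinearMap ∘ₗ
    LinearMap.compLeft (LinearMap.toSpanSingleton k T t) (Arr C) ∘ₗ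
      Function.ExtendByZero.linearMap k (fun f : Irr c d => (⟨c, d, f.1⟩ : Arr C))

theorem irrMap_of (t : T) (ψ : Irr c d → k) {a b : C} (f : a ⟶ b) :
    irrMap t ψ (of k f) =
      Function.extend (fun f : Irr c d => (⟨c, d, f.1⟩ : Arr C)) ψ 0 ⟨a, b, f⟩ • t := by
  simp only [irrMap, of, LinearMap.comp_apply]
  exact (basis k C).constr_basis k _ _

theorem irrMap_of_irr (t : T) (ψ : Irr c d → k) (f : Irr c d) :
    irrMap t ψ (of k f.1) = ψ f • t := by
  rw [irrMap_of, Function.Injective.extend_apply (f := fun f : Irr c d => (⟨c, d, f.1⟩ : Arr C))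
    (fun f g h => Subtype.ext (by simpa using h))]

theorem irrMap_of_not_irr (t : T) (ψ : Irr c d → k) {a b : C} (f : a ⟶ b)
    (hf : ∀ g : Irr c d, (⟨c, d, g.1⟩ : Arr C) ≠ ⟨a, b, f⟩) :
    irrMap t ψ (of k f) = 0 := by
  rw [irrMap_of, Function.extend_apply' _ _ _ (by rintro ⟨g, hg⟩; exact hf g hg),
    Pi.zero_apply, zero_smul]

end IrrMap

/-! ### Homomorphisms from the radical of a vertex projective -/

section Hom

variable {c d : C} {S T : Type*} [AddCommGroup S] [Module (CategoryAlgebra k C) S]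
  [AddCommGroup T] [Module (CategoryAlgebra k C) T] [Module k T]

variable (k c) in
/-- The action on an element of a module, restricted to the projective module at `c`. -/
def vertexMap (s : S) : vertexProjective k c →ₗ[CategoryAlgebra k C] S :=
  (LinearMap.toSpanSingleton (CategoryAlgebra k C) S s).comp (vertexProjective k c).subtype

theorem vertexMap_apply (s : S) (x : vertexProjective k c) :
    vertexMap k c s x = (x : CategoryAlgebra k C) • s := rfl

theorem IsVertexModule.vertexMap_surjective [IsSimpleModule (CategoryAlgebra k C) S]
    (hS : IsVertexModule k c S) {s : S} (hs : s ≠ 0) : Function.Surjective (vertexMap k c s) := by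
  intro t
  obtain ⟨y, rfl⟩ := IsSimpleModule.toSpanSingleton_surjective (CategoryAlgebra k C) hs t
  refine ⟨⟨y * of k (𝟙 c), mul_of_id_mem_vertexProjective c y⟩, ?_⟩
  rw [vertexMap_apply, mul_smul, hS.id_smul]
  rfl

variable [Module k S] [IsScalarTower k (CategoryAlgebra k C) S]

theorem IsVertexModule.mem_ker_vertexMap (hS : IsVertexModule k c S) {s : S} (hs : s ≠ 0)
    {x : vertexProjective k c} :
    x ∈ LinearMap.ker (vertexMap k c s) ↔ vertexCoeff k c (x : CategoryAlgebra k C) = 0 := by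
  rw [LinearMap.mem_ker, vertexMap_apply, hS.smul_eq, smul_eq_zero_iff_left hs]

theorem IsVertexModule.mem_outSpan (hS : IsVertexModule k c S) (hloc : LocallyTrivial C) {s : S}
    (hs : s ≠ 0) (x : LinearMap.ker (vertexMap k c s)) :
    (x : CategoryAlgebra k C) ∈ outSpan k c := by
  have h := mul_of_id_sub_mem_outSpan hloc c (x : CategoryAlgebra k C)
  rwa [(hS.mem_ker_vertexMap hs).1 x.2, zero_smul, sub_zero,
    mem_vertexProjective.1 x.1.2] at h

/-- A morphism with source `c` and a different target, as an element of the radical of the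
projective module at `c`. -/
def IsVertexModule.kerOf (hS : IsVertexModule k c S) (hloc : LocallyTrivial C) {s : S}
    (hs : s ≠ 0) {b : C} (f : c ⟶ b) (hb : c ≠ b) : LinearMap.ker (vertexMap k c s) :=
  ⟨⟨of k f, of_mem_vertexProjective f⟩, by
    classical
    rw [hS.mem_ker_vertexMap hs, vertexCoeff_of hloc, if_neg (fun h => hb h.2.symm)]⟩

/-- Every homomorphism from the projective module at `c` to a simple module at a vertex vanishes on
the radical. -/
theorem IsVertexModule.comp_ker_subtype_eq_zero (hS : IsVertexModule k c S)
    [IsScalarTower k (CategoryAlgebra k C) T] (hT : IsVertexModule k d T) {s : S} (hs : s ≠ 0)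
    (g : vertexProjective k c →ₗ[CategoryAlgebra k C] T) :
    g.comp (LinearMap.ker (vertexMap k c s)).subtype = 0 := by
  ext x
  let e : vertexProjective k c := ⟨of k (𝟙 c), of_mem_vertexProjective _⟩
  -- Since `e` generates the projective, `g x = x • g e`. If `c = d`, then `x` acts by its zero
  -- coefficient; otherwise `1_c` kills `g e`.
  have hx : (x : vertexProjective k c) = (x : CategoryAlgebra k C) • e :=
    Subtype.ext (mem_vertexProjective.1 x.1.2).symm
  have hx0 := (hS.mem_ker_vertexMap hs).1 x.2
  rw [LinearMap.comp_apply, Submodule.subtype_apply, hx, map_smul, LinearMap.zero_apply]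
  by_cases hcd : c = d
  · subst hcd
    rw [hT.smul_eq, hx0, zero_smul]
  · have he : e = of k (𝟙 c) • e := Subtype.ext (mem_vertexProjective.1 e.2).symm
    rw [he, map_smul, hT.of_smul c c (𝟙 c) (fun h => hcd (congrArg Arr.src h)), smul_zero]

/-- For composable non-identities `f` and `g` the composite is reducible and `g` kills `T`, so both
sides vanish. The assumption `c ≠ b` is essential: for `f = 𝟙 c` and `g` irreducible the left side
may be nonzero while the right side is zero. -/
theorem IsVertexModule.irrMap_of_mul_of (hT : IsVertexModule k d T) (hloc : LocallyTrivial C)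
    (hskel : Skeletal C) (t : T) (ψ : Irr c d → k) {b a e : C} (f : c ⟶ b) (hb : c ≠ b)
    (g : a ⟶ e) : irrMap t ψ (of k g * of k f) = of k g • irrMap t ψ (of k f) := by
  have hzero (h : d ≠ b) : irrMap t ψ (of k f) = 0 :=
    irrMap_of_not_irr t ψ f fun g hg => h (congrArg Arr.tgt hg)
  by_cases hba : b = a
  · subst hba
    by_cases hbe : b = e
    · subst hbe
      rw [hloc _ g, of_mul_of, Category.comp_id]
      by_cases hd : d = b
      · subst hd
        rw [hT.id_smul]
      · rw [hzero hd, smul_zero]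
    · rw [of_mul_of, irrMap_of_not_irr t ψ (f ≫ g), hT.of_smul b e g]
      · intro h
        exact hbe ((congrArg Arr.src h).trans (congrArg Arr.tgt h).symm)
      · intro ψ hψ
        obtain rfl : d = e := congrArg Arr.tgt hψ
        obtain hψ : ψ.1 = f ≫ g := by simpa using hψ
        exact (((hloc.isIrreducibleMorphism_iff hskel _).1 ψ.2).2 b f g hψ).elim hb hbe
  · rw [of_mul_of_of_ne k _ _ hba, map_zero]
    by_cases hd : d = b
    · subst hd
      rw [hT.of_smul a e g fun h => hba (congrArg Arr.src h).symm]
    · rw [hzero hd, smul_zero]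

variable [IsScalarTower k (CategoryAlgebra k C) T]

theorem IsVertexModule.irrMap_mul (hT : IsVertexModule k d T) (hloc : LocallyTrivial C)
    (hskel : Skeletal C) (t : T) (ψ : Irr c d → k) (a : CategoryAlgebra k C)
    {x : CategoryAlgebra k C} (hx : x ∈ outSpan k c) :
    irrMap t ψ (a * x) = a • irrMap t ψ x := by
  have : SMulCommClass k (CategoryAlgebra k C) T := IsScalarTower.to_smulCommClass
  induction hx using Submodule.span_induction with
  | zero => simp
  | add x y _ _ hx hy => rw [mul_add, map_add, hx, hy, map_add, smul_add]
  | smul r x _ hx => rw [mul_smul_comm, map_smul, hx, map_smul, smul_comm]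
  | mem x hx =>
    obtain ⟨b, f, hb, rfl⟩ := hx
    induction a using induction_on with
    | zero => simp
    | add x y hx hy => rw [add_mul, map_add, hx, hy, add_smul]
    | smul r _ _ g =>
      rw [smul_mul_assoc, map_smul, hT.irrMap_of_mul_of hloc hskel t ψ f hb, smul_assoc]

variable [SMulCommClass (CategoryAlgebra k C) k T]

/-- Scalar functions on the irreducible morphisms from `c` to `d` are the homomorphisms from the
radical of the projective module at `c` to the simple module at `d`. -/
def IsVertexModule.irrHom (hS : IsVertexModule k c S) (hT : IsVertexModule k d T)
    (hloc : LocallyTrivial C) (hskel : Skeletal C) {s : S} (hs : s ≠ 0) (t : T) :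
    (Irr c d → k) →ₗ[k] (LinearMap.ker (vertexMap k c s) →ₗ[CategoryAlgebra k C] T) where
  toFun ψ :=
    { toFun x := irrMap t ψ (x : CategoryAlgebra k C)
      map_add' x y := map_add (irrMap t ψ) (x : CategoryAlgebra k C) y
      map_smul' a x := hT.irrMap_mul hloc hskel t ψ a (hS.mem_outSpan hloc hs x) }
  map_add' ψ ψ' := by
    ext x
    simp
  map_smul' r ψ := by
    ext x
    simp

theorem IsVertexModule.irrHom_apply (hS : IsVertexModule k c S) (hT : IsVertexModule k d T)
    (hloc : LocallyTrivial C) (hskel : Skeletal C) {s : S} (hs : s ≠ 0) (t : T) (ψ : Irr c d → k)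
    (x : LinearMap.ker (vertexMap k c s)) :
    hS.irrHom hT hloc hskel hs t ψ x = irrMap t ψ (x : CategoryAlgebra k C) := rfl

theorem IsVertexModule.irrHom_injective (hS : IsVertexModule k c S) (hT : IsVertexModule k d T)
    (hloc : LocallyTrivial C) (hskel : Skeletal C) {s : S} (hs : s ≠ 0) {t : T} (ht : t ≠ 0) :
    Function.Injective (hS.irrHom hT hloc hskel hs t) := by
  rw [injective_iff_map_eq_zero]
  intro ψ hψ
  ext f
  have hcd := ((hloc.isIrreducibleMorphism_iff hskel _).1 f.2).1
  have h := LinearMap.congr_fun hψ (hS.kerOf hloc hs f.1 hcd)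
  rw [hS.irrHom_apply] at h
  exact (smul_eq_zero_iff_left ht).1 ((irrMap_of_irr t ψ f).symm.trans h)

/-- Since `T` is the line through `t`, the values of `φ` on irreducible morphisms define `ψ`; it
remains to see that `φ` vanishes on all other morphisms in the spanning set. -/
theorem IsVertexModule.irrHom_surjective (hS : IsVertexModule k c S) (hT : IsVertexModule k d T)
    [IsSimpleModule (CategoryAlgebra k C) T]
    (hloc : LocallyTrivial C) (hskel : Skeletal C) {s : S} (hs : s ≠ 0) {t : T} (ht : t ≠ 0) :
    Function.Surjective (hS.irrHom hT hloc hskel hs t) := by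
  intro φ
  have hspan (t' : T) : ∃ r : k, t' = r • t := by
    obtain ⟨y, rfl⟩ := IsSimpleModule.toSpanSingleton_surjective (CategoryAlgebra k C) ht t'
    exact ⟨_, hT.smul_eq y t⟩
  have hne (f : Irr c d) : c ≠ d := ((hloc.isIrreducibleMorphism_iff hskel _).1 f.2).1
  choose ψ hψ using fun f : Irr c d => hspan (φ (hS.kerOf hloc hs f.1 (hne f)))
  have key {b : C} (f : c ⟶ b) (hb : c ≠ b) :
      irrMap t ψ (of k f) = φ (hS.kerOf hloc hs f hb) := by
    by_cases hf : ∃ g : Irr c d, (⟨c, d, g.1⟩ : Arr C) = ⟨c, b, f⟩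
    · obtain ⟨g, hg⟩ := hf
      obtain rfl : d = b := congrArg Arr.tgt hg
      obtain rfl : g.1 = f := by simpa using hg
      rw [irrMap_of_irr, hψ]
    · rw [irrMap_of_not_irr t ψ f fun g hg => hf ⟨g, hg⟩]
      by_cases hd : b = d
      · subst hd
        have hirr : ¬ IsIrreducibleMorphism f := fun h => hf ⟨⟨f, h⟩, rfl⟩
        rw [hloc.isIrreducibleMorphism_iff hskel] at hirr
        push Not at hirr
        obtain ⟨x, h, g, rfl, hcx, hxb⟩ := hirr hb
        -- The first factor `h` already lies in the radical, so `φ` of the composite is `g • φ h`,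
        -- and `g` kills `T`.
        have : hS.kerOf hloc hs (h ≫ g) hb = of k g • hS.kerOf hloc hs h hcx :=
          Subtype.ext (Subtype.ext (of_mul_of k g h).symm)
        rw [this, map_smul, hT.of_smul x b g fun h => hxb (congrArg Arr.src h)]
      · have : hS.kerOf hloc hs f hb = of k (𝟙 b) • hS.kerOf hloc hs f hb :=
          Subtype.ext (Subtype.ext (by
            change of k f = of k (𝟙 b) * of k f
            rw [of_mul_of, Category.comp_id]))
        rw [this, map_smul, hT.of_smul b b (𝟙 b) fun h => hd (congrArg Arr.src h)]
  refine ⟨ψ, LinearMap.ext fun x => ?_⟩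
  rw [hS.irrHom_apply]
  -- Span induction runs over elements of the algebra, where `φ` is not defined; the existential
  -- carries a lift to the kernel along.
  have hmem {y : CategoryAlgebra k C} (hy : y ∈ outSpan k c) :
      ∃ z : LinearMap.ker (vertexMap k c s), (z : CategoryAlgebra k C) = y ∧
        irrMap t ψ y = φ z := by
    induction hy using Submodule.span_induction with
    | zero => exact ⟨0, rfl, by rw [map_zero, map_zero]⟩
    | add x y _ _ hx hy =>
      obtain ⟨x', rfl, hx⟩ := hx
      obtain ⟨y', rfl, hy⟩ := hy
      exact ⟨x' + y', rfl, by rw [map_add, hx, hy, map_add]⟩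
    | smul r x _ hx =>
      obtain ⟨x', rfl, hx⟩ := hx
      refine ⟨algebraMap k (CategoryAlgebra k C) r • x', ?_, ?_⟩
      · exact (Algebra.smul_def r _).symm
      · rw [map_smul, hx, map_smul, algebraMap_smul]
    | mem x hx =>
      obtain ⟨b, f, hb, rfl⟩ := hx
      exact ⟨_, rfl, key f hb⟩
  obtain ⟨z, hz, h⟩ := hmem (hS.mem_outSpan hloc hs x)
  rw [h, Subtype.ext (Subtype.ext hz)]

end Hom

open scoped ModuleCat in
/-- The functions on the irreducible morphisms from `c` to `d` form the space `Ext¹` between simple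
modules at `c` and `d`. -/
theorem IsVertexModule.nonempty_linearEquiv_ext (hloc : LocallyTrivial C) (hskel : Skeletal C)
    {c d : C} (S T : SimpleMod (CategoryAlgebra k C)) (hS : IsVertexModule k c S.1)
    (hT : IsVertexModule k d T.1) :
    Nonempty (Abelian.Ext.{max w u v} S.1 T.1 1 ≃ₗ[k] (Irr c d → k)) := by
  have := S.2
  have := T.2
  have := IsSimpleModule.nontrivial (CategoryAlgebra k C) S.1
  have := IsSimpleModule.nontrivial (CategoryAlgebra k C) T.1
  obtain ⟨s, hs⟩ := exists_ne (0 : S.1)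
  obtain ⟨t, ht⟩ := exists_ne (0 : T.1)
  have hex := LinearMap.shortExact_shortComplexKer (hS.vertexMap_surjective hs)
  have : Projective (vertexMap k c s).shortComplexKer.X₂ :=
    (IsProjective.iff_projective (vertexProjective k c)).1 inferInstance
  let e₁ := hex.homLinearEquivExtOne (k := k) T.1 fun g => by
    ext1
    exact hS.comp_ker_subtype_eq_zero hT hs g.hom
  let e₂ := LinearEquiv.ofBijective (hS.irrHom hT hloc hskel hs t)
    ⟨hS.irrHom_injective hT hloc hskel hs ht, hS.irrHom_surjective hT hloc hskel hs ht⟩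
  exact ⟨e₁.symm.trans ((ModuleCat.homLinearEquiv (S := k)).trans e₂.symm)⟩

end CategoryAlgebra

/-! ### Assembling the isomorphism of quivers -/

theorem Irr.finite {C : Type u} [Category.{v} C] (c d : C) [Finite (c ⟶ d)] : Finite (Irr c d) :=
  Subtype.finite

/-- The isomorphism between the quiver of a skeletal category and the quiver of its irreducible
morphisms. -/
def CategoryQuiver.isoIrrQuiver (C : Type u) [Category.{v} C] (hskel : Skeletal C) :
    QuiverIso (CategoryQuiver C) (IrrQuiver C) where
  vertices :=
    { toFun := Quotient.out
      invFun := fun c => Quotient.mk (isIsomorphicSetoid C) c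
      left_inv := Quotient.out_eq
      right_inv := fun c => hskel (Quotient.mk_out (s := isIsomorphicSetoid C) c) }
  -- Both arrow sets are, by definition, the irreducible morphisms between the chosen
  -- representatives.
  arrows _ _ := Equiv.refl _

/-- The composition of two isomorphisms of quivers. -/
def QuiverIso.trans {V W X : Type*} [Quiver V] [Quiver W] [Quiver X] (e : QuiverIso V W)
    (e' : QuiverIso W X) : QuiverIso V X where
  vertices := e.vertices.trans e'.vertices
  arrows x y := (e.arrows x y).trans (e'.arrows _ _)

namespace CategoryAlgebra

variable {k : Type w} [Field k] {C : Type u} [Category.{v} C] [Finite C]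

/-- The simple module at a vertex as an object of the category of simple modules. -/
def vertexSimpleMod (k : Type w) [Field k] (hloc : LocallyTrivial C) (hskel : Skeletal C) (c : C) :
    SimpleMod (CategoryAlgebra k C) :=
  ⟨ModuleCat.of (CategoryAlgebra k C) (VertexSimple k hloc hskel c),
    isSimpleModule_vertexSimple hloc hskel c⟩

theorem isVertexModule_vertexSimpleMod (hloc : LocallyTrivial C) (hskel : Skeletal C) (c : C) :
    IsVertexModule k c (vertexSimpleMod k hloc hskel c).1 :=
  isVertexModule_vertexSimple hloc hskel c

/-- This criterion makes the `Ext¹` computation applicable to whichever representative of a class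
was chosen. -/
theorem mk_vertexSimpleMod_eq_mk_iff (hloc : LocallyTrivial C) (hskel : Skeletal C) (c : C)
    (S : SimpleMod (CategoryAlgebra k C)) :
    GabrielQuiver.mk (k := k) (vertexSimpleMod k hloc hskel c) = GabrielQuiver.mk S ↔
      IsVertexModule k c S.1 := by
  have := S.2
  constructor
  · intro h
    obtain ⟨e⟩ := Quotient.exact h
    exact (isVertexModule_vertexSimpleMod hloc hskel c).of_linearEquiv e.toLinearEquiv
  · intro h
    obtain ⟨e⟩ := h.nonempty_linearEquiv hloc hskel
    exact Quotient.sound ⟨e.toModuleIso⟩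

theorem mk_vertexSimpleMod_bijective (hloc : LocallyTrivial C) (hskel : Skeletal C) :
    Function.Bijective fun c : C =>
      GabrielQuiver.mk (k := k) (vertexSimpleMod k hloc hskel c) := by
  constructor
  · intro c d h
    have := isSimpleModule_vertexSimple (k := k) hloc hskel d
    have : Nontrivial (vertexSimpleMod k hloc hskel d).1 :=
      IsSimpleModule.nontrivial (CategoryAlgebra k C) (VertexSimple k hloc hskel d)
    exact ((mk_vertexSimpleMod_eq_mk_iff hloc hskel c _).1 h).eq
      (isVertexModule_vertexSimpleMod hloc hskel d)
  · intro x
    obtain ⟨S, rfl⟩ := Quotient.exists_rep x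
    have := S.2
    obtain ⟨c, hc⟩ := exists_isVertexModule (k := k) hloc hskel S.1
    exact ⟨c, (mk_vertexSimpleMod_eq_mk_iff hloc hskel c S).2 hc⟩

theorem isVertexModule_rep (hloc : LocallyTrivial C) (hskel : Skeletal C) (c : C) :
    IsVertexModule k c
      (GabrielQuiver.rep (GabrielQuiver.mk (k := k) (vertexSimpleMod k hloc hskel c))) :=
  (mk_vertexSimpleMod_eq_mk_iff hloc hskel c _).1 (Quotient.out_eq _).symm

/-- The quiver of irreducible morphisms is the Gabriel quiver of the category algebra. -/
def irrQuiverIso (k : Type w) [Field k] [hfin : ∀ c d : C, Finite (c ⟶ d)]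
    (hloc : LocallyTrivial C) (hskel : Skeletal C) :
    QuiverIso (IrrQuiver C) (GabrielQuiver k (CategoryAlgebra k C)) where
  vertices := Equiv.ofBijective _ (mk_vertexSimpleMod_bijective hloc hskel)
  arrows c d :=
    haveI : Finite (Irr (C := C) c d) := @Irr.finite C _ c d (hfin c d)
    -- The arrows of the Gabriel quiver index a chosen basis of `Ext¹`; another basis is indexed by
    -- `Irr c d`, and any two bases have equivalent index sets.
    (Module.Basis.ofEquivFun (IsVertexModule.nonempty_linearEquiv_ext hloc hskel
      (Quotient.out (GabrielQuiver.mk (k := k) (vertexSimpleMod k hloc hskel c)))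
      (Quotient.out (GabrielQuiver.mk (k := k) (vertexSimpleMod k hloc hskel d)))
      (isVertexModule_rep hloc hskel c) (isVertexModule_rep hloc hskel d)).some).indexEquiv
      (Module.Basis.ofVectorSpace k _)

end CategoryAlgebra

end

theorem mainTheorem11 (k : Type w) [Field k] (C : Type u) [Category.{v} C] [Finite C]
    [∀ c d : C, Finite (c ⟶ d)] (hskel : Skeletal C) (hloc : LocallyTrivial C) :
    SplitsOver k (CategoryAlgebra k C) ∧
    Nonempty (QuiverIso (CategoryQuiver C) (GabrielQuiver k (CategoryAlgebra k C))) ∧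
    ∃ e : QuiverIso (IrrQuiver C) (GabrielQuiver k (CategoryAlgebra k C)),
      ∀ (c : C) (S : SimpleMod (CategoryAlgebra k C)), e.vertices c = GabrielQuiver.mk S →
        (∀ s : S.1, CategoryAlgebra.of k (𝟙 c) • s = s) ∧
        ∀ (a b : C) (f : a ⟶ b), (⟨a, b, f⟩ : Arr C) ≠ ⟨c, c, 𝟙 c⟩ →
          ∀ s : S.1, CategoryAlgebra.of k f • s = 0 := by
  refine ⟨CategoryAlgebra.splitsOver hloc hskel,
    ⟨(CategoryQuiver.isoIrrQuiver C hskel).trans (CategoryAlgebra.irrQuiverIso k hloc hskel)⟩,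
    CategoryAlgebra.irrQuiverIso k hloc hskel, fun c S h => ?_⟩
  have hc := (CategoryAlgebra.mk_vertexSimpleMod_eq_mk_iff hloc hskel c S).1 h
  exact ⟨hc.id_smul, hc.of_smul⟩
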